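/- Let $\pi$ be a probability distribution on a finite set $S$, let $K$ be a transition matrix on $S$ with $\pi_i k_{ij}=\pi_j k_{ji}$ for all $i,j$ (irreducibility is not assumed), let $g:S\to[0,1]$, and put $\bar g=\sum_s \pi_s\, g(s)$. Let $\tau_2=1/(1-\lambda_2)$, with $\tau_2=\infty$ if $\lambda_2=1$, where $\lambda_2$ is the second largest of the real eigenvalues of $K$, counted with algebraic multiplicity (all eigenvalues of $K$ are real if $\pi$ is strictly positive; if there is no second real eigenvalue, put $\lambda_2=-1$). Let $n\ge 3$ and $m\ge 1$ be integers, let $0<\alpha<1$, and let $\hat\tau\ge 1$ be real. Then, from $2n$ exact samples from $\pi$ and $2mn$ steps of the $K$-chain, one can construct an interval $I$ with $$\mathbf P(\bar g\notin I)\le\alpha$$ and $$\mathbf P\Big(\mathrm{length}(I)>k_\alpha\,\max\Big(\frac1n,\sqrt{\frac{\hat\tau}{nm}}\Big)\log n\Big)\le 3n(n+1)\exp\Big(-\frac{m}{48\,n\,\tau_2}\log^2 n\Big),$$ where $k_\alpha=2\big(\sqrt{2/\alpha}+\log(4/\alpha)\big)$. Explicitly, let $(X^*_{ij})_{0\le j<m}$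 and $(X_{ij})_{0\le j<m}$, $1\le i\le n$, be $2n$ independent $K$-chains with initial distribution $\pi$. Put $A^*_i=\frac1m\sum_j g(X^*_{ij})$, $\bar g^*=\frac1n\sum_i A^*_i$ and $A_i=\frac1m\sum_j g(X_{ij})$. Let $\tilde A_i=A_i$ if $|A_i-\bar g^*|\le \log n/\sqrt{\min(n,m/\hat\tau)}$ and $\tilde A_i=\bar g^*$ otherwise, and let $N$ be the number of $i$ with $\tilde A_i\ne A_i$. Both bounds hold for the closed interval $I$ with centre $\frac1n\sum_i\tilde A_i$ and half-length $$\sqrt{\frac2\alpha}\,\max\Big(\frac1n,\sqrt{\frac{\hat\tau}{nm}}\Big)\log n+h,\qquad h=\begin{cases}\dfrac1n\log\dfrac4\alpha,& N=0,\\[2mm] \dfrac Nn+\dfrac1{\sqrt{\alpha n}},& N\neq0.\end{cases}$$ This $I$ depends only on $n,m,\alpha,\hat\tau$ and the observed values of $g$, not on $\pi$ or $K$. -/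

import Mathlib

open MeasureTheory ProbabilityTheory
open scoped ENNReal

noncomputable section

namespace MCMC

/-- The second largest eigenvalue `lambda_2` of `K`: the second entry of the list, in decreasing
order and with algebraic multiplicity, of the real eigenvalues of `K`. (All eigenvalues are real
when `K` is reversible with respect to a strictly positive `π`.) If there is no second entry, as on
a one-point space, the value is `-1`, the smallest one an eigenvalue could have. -/
def secondEigenvalue {S : Type*} [Fintype S] [DecidableEq S] (K : Matrix S S ℝ) : ℝ :=
  (K.charpoly.roots.sort (· ≥ ·)).getD 1 (-1)

/-- The relaxation time `1 / (1 - lambda_2)`; it is `∞` if `lambda_2 = 1`. -/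
def relaxationTime {S : Type*} [Fintype S] [DecidableEq S] (K : Matrix S S ℝ) : ℝ≥0∞ :=
  (ENNReal.ofReal (1 - secondEigenvalue K))⁻¹

/-- The probability `π(x₀) K(x₀,x₁) ⋯ K(x_{m-2},x_{m-1})` of the path `x₀, …, x_{m-1}`. -/
def pathProb {S : Type*} (π : S → ℝ) (K : Matrix S S ℝ) {m : ℕ} (hm : 1 ≤ m)
    (x : Fin m → S) : ℝ :=
  π (x ⟨0, by omega⟩) *
    ∏ j : Fin (m - 1), K (x ⟨j.val, by omega⟩) (x ⟨j.val + 1, by omega⟩)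

/-- `X 0, …, X (m-1)` are the first `m` states of a Markov chain with initial distribution `π`
(that is, `X 0` is an exact sample from `π`) and transition matrix `K`. -/
structure IsChain {S Ω : Type*} [MeasurableSpace S] [MeasurableSpace Ω] (P : Measure Ω)
    (π : S → ℝ) (K : Matrix S S ℝ) {m : ℕ} (hm : 1 ≤ m) (X : Fin m → Ω → S) : Prop where
  measurable : ∀ j, Measurable (X j)
  law : ∀ x : Fin m → S, P {ω | ∀ j, X j ω = x j} = ENNReal.ofReal (pathProb π K hm x)

section Interval

/-! The confidence interval as a function of the observed `g`-values: `ys i j` is the value at time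
`j` along the `i`-th chain of the first (pilot) run, `y i j` the one for the second run. -/

variable {n m : ℕ}

/-- `A_i`, the average over the `i`-th chain. -/
def chainAvg (y : Fin n → Fin m → ℝ) (i : Fin n) : ℝ := (∑ j, y i j) / m

/-- The overall average over a run; for the first run this is the pilot estimate. -/
def overallAvg (y : Fin n → Fin m → ℝ) : ℝ := (∑ i, chainAvg y i) / n

/-- The truncation level `log n / √(min (n, m/τ))`. -/
def truncLevel (n m : ℕ) (τ : ℝ) : ℝ := Real.log n / √(min (n : ℝ) (m / τ))

/-- The average `A_i` of the second run, replaced by the pilot estimate if it is too far away. -/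
def truncAvg (τ : ℝ) (ys y : Fin n → Fin m → ℝ) (i : Fin n) : ℝ :=
  if |chainAvg y i - overallAvg ys| ≤ truncLevel n m τ then chainAvg y i else overallAvg ys

/-- The average of the truncated variables: the centre of the interval. -/
def truncMean (τ : ℝ) (ys y : Fin n → Fin m → ℝ) : ℝ := (∑ i, truncAvg τ ys y i) / n

open Classical in
/-- The number of truncations. -/
def numTrunc (τ : ℝ) (ys y : Fin n → Fin m → ℝ) : ℕ :=
  (Finset.univ.filter fun i => chainAvg y i ≠ truncAvg τ ys y i).card

/-- The order of magnitude `max (1/n, √(τ/(nm)))` of the error. -/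
def err (n m : ℕ) (τ : ℝ) : ℝ := max (1 / (n : ℝ)) (√(τ / (n * m)))

/-- The term by which the number `z` of truncations enters the width of the interval. -/
def truncWidth (z n : ℕ) (α : ℝ) : ℝ :=
  if z = 0 then Real.log (2 / α) / n else z / n + (1 / √(2 * α)) / √n

/-- Half the length of the interval. -/
def halfLength (τ α : ℝ) (ys y : Fin n → Fin m → ℝ) : ℝ :=
  √(2 / α) * err n m τ * Real.log n + truncWidth (numTrunc τ ys y) n (α / 2)

/-- The confidence interval. -/
def confInterval (τ α : ℝ) (ys y : Fin n → Fin m → ℝ) : Set ℝ :=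
  Set.Icc (truncMean τ ys y - halfLength τ α ys y) (truncMean τ ys y + halfLength τ α ys y)

end Interval

/-- The constant `k_α`. -/
def kConst (α : ℝ) : ℝ := 2 * (√(2 / α) + Real.log (4 / α))

end MCMC

end

/-! Coverage needs no mixing. Fix the pilot run, and with it the pilot mean `b`; let `T` be the
truncation at distance `d = truncLevel` from `b`. The variables `T (A i)` are independent with
values in an interval of length `2d`, so Chebyshev controls their mean up to probability `α/2`.
Since `A i` and `b` lie in `[0,1]`, the bias of that mean is at most `(∑ q i)/n`, where `q i` is the
probability that `A i` is truncated. The sum `∑ q i` is the expected number of truncations and can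
be read off the observed number `N`: by Chebyshev for `N` if `N ≠ 0`, and by `P(N = 0) ≤ exp (-∑ q
i)` if `N = 0`, each failing with probability at most `α/4` (`measureReal_truncation_le`).
Independence of the two runs then lets the pilot be random.

For the length, `N = 0` already makes the interval short, and `N = 0` as soon as all `2n` chain
averages are within `log n / (2√n)` of the mean of `g`. This is a union bound over a Chernoff
inequality for stationary reversible chains (`IsChain.measureReal_mul_le_sum_le`). There the moment
generating function is a path sum, bounded by the norm of the kernel tilted by `exp (θ f)`
(`sum_pathSum_const_le`), and the spectral gap bounds that norm (`form_le_exp_mul`). -/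

namespace MCMC

/-! ### Spectral gap of a reversible, possibly reducible, kernel. -/

/-- By counting: at most one entry of a decreasing list exceeds its second entry, so `a` and `b`
cannot both do so. -/
theorem min_le_sort_getD_one {s : Multiset ℝ} {a b : ℝ} (d : ℝ) (h : ({a, b} : Multiset ℝ) ≤ s) :
    min a b ≤ (s.sort (· ≥ ·)).getD 1 d := by
  have hs : ((s.sort (· ≥ ·) : List ℝ) : Multiset ℝ) = s := Multiset.sort_eq s _
  have hp : (s.sort (· ≥ ·)).Pairwise (· ≥ ·) := Multiset.pairwise_sort s _
  have hc : 2 ≤ s.card := by simpa using Multiset.card_le_card h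
  generalize s.sort (· ≥ ·) = l at hs hp
  subst hs
  match l, hc, hp, h with
  | x :: y :: t, _, hp, h =>
    change min a b ≤ y
    by_contra! hlt
    obtain ⟨ha, hb⟩ := lt_min_iff.mp hlt
    have ht : ∀ z ∈ t, ¬ y < z := by
      simp only [List.pairwise_cons] at hp
      intro z hz
      exact not_lt.mpr (hp.2.1 z hz)
    have h1 := Multiset.card_le_card (Multiset.filter_le_filter (y < ·) h)
    have h2 : Multiset.filter (y < ·) ({a, b} : Multiset ℝ) = {a, b} := by
      refine Multiset.filter_eq_self.mpr ?_
      simp [ha, hb]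
    have h3 : t.filter (fun z => decide (y < z)) = [] := by
      simpa [List.filter_eq_nil_iff] using ht
    rw [h2] at h1
    by_cases hx : y < x <;> simp [h3, hx] at h1

-- All eigenvalues but the largest are at most `l < 1`, so the fixed vector `e` is a multiple of the
-- top eigenvector. Orthogonality to `e` thus removes the top term from the spectral expansion of
-- the form.
open Matrix in
theorem dotProduct_mulVec_le_of_forall_min_eigenvalues_le {T : Type*} [Fintype T] [DecidableEq T]
    {A : Matrix T T ℝ} (hA : A.IsHermitian) {l : ℝ} (hl : l < 1)
    (hmin : ∀ i j, i ≠ j → min (hA.eigenvalues i) (hA.eigenvalues j) ≤ l)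
    {e : T → ℝ} (he : e ≠ 0) (hAe : A *ᵥ e = e) {h : T → ℝ} (heh : e ⬝ᵥ h = 0) :
    h ⬝ᵥ (A *ᵥ h) ≤ l * (h ⬝ᵥ h) := by
  set v : T → T → ℝ := fun i => (hA.eigenvectorBasis i).ofLp with hv
  have hP : ∀ x y : T → ℝ, ∑ i, (v i ⬝ᵥ x) * (v i ⬝ᵥ y) = x ⬝ᵥ y := by
    intro x y
    have := hA.eigenvectorBasis.sum_inner_mul_inner (WithLp.toLp 2 x) (WithLp.toLp 2 y)
    simp only [EuclideanSpace.inner_eq_star_dotProduct, star_trivial] at this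
    rw [dotProduct_comm, ← this]
    exact Finset.sum_congr rfl fun i _ => by rw [dotProduct_comm y]
  have hsymm : ∀ x y : T → ℝ, x ⬝ᵥ (A *ᵥ y) = (A *ᵥ x) ⬝ᵥ y := by
    intro x y
    have hT : Aᵀ = A := by rw [← conjTranspose_eq_transpose_of_trivial, hA.eq]
    rw [dotProduct_mulVec, ← mulVec_transpose, hT]
  have hv1 : ∀ i (x : T → ℝ), v i ⬝ᵥ (A *ᵥ x) = hA.eigenvalues i * (v i ⬝ᵥ x) := by
    intro i x
    rw [hsymm, hv, hA.mulVec_eigenvectorBasis, smul_dotProduct, smul_eq_mul]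
  have hne : Nonempty T := by
    by_contra hne
    rw [not_nonempty_iff] at hne
    exact he (Subsingleton.elim _ _)
  obtain ⟨i₀, hi₀⟩ := Finite.exists_max hA.eigenvalues
  have hle : ∀ i, i ≠ i₀ → hA.eigenvalues i ≤ l := by
    intro i hi
    have := hmin i i₀ hi
    rwa [min_eq_left (hi₀ i)] at this
  have hve : ∀ i, i ≠ i₀ → v i ⬝ᵥ e = 0 := by
    intro i hi
    have h1 := hv1 i e
    rw [hAe] at h1
    have h2 : (1 - hA.eigenvalues i) * (v i ⬝ᵥ e) = 0 := by linarith
    rcases mul_eq_zero.mp h2 with h | h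
    · linarith [hle i hi]
    · exact h
  have he0 : (v i₀ ⬝ᵥ e) * (v i₀ ⬝ᵥ h) = 0 := by
    have h1 := hP e h
    rwa [Finset.sum_eq_single i₀ (fun i _ hi => by rw [hve i hi, zero_mul])
      fun hi => absurd (Finset.mem_univ _) hi, heh] at h1
  have he1 : v i₀ ⬝ᵥ e ≠ 0 := by
    intro h0
    have : e ⬝ᵥ e = 0 := by
      rw [← hP e e]
      refine Finset.sum_eq_zero fun i _ => ?_
      by_cases hi : i = i₀
      · rw [hi, h0, zero_mul]
      · rw [hve i hi, zero_mul]
    exact he (dotProduct_self_eq_zero.mp this)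
  have hh0 : v i₀ ⬝ᵥ h = 0 := (mul_eq_zero.mp he0).resolve_left he1
  rw [← hP h (A *ᵥ h), ← hP h h, Finset.mul_sum]
  refine Finset.sum_le_sum fun i _ => ?_
  rw [hv1]
  by_cases hi : i = i₀
  · simp [hi, hh0]
  · nlinarith [hle i hi, mul_self_nonneg (v i ⬝ᵥ h)]

section SpectralGap

variable {S : Type*} [Fintype S] [DecidableEq S]

/-- When `p` is a closed class, `K` is block triangular and its characteristic polynomial factors.
This is applied to the support of `π`. -/
theorem charpoly_toSquareBlockProp_dvd (K : Matrix S S ℝ) (p : S → Prop) [DecidablePred p]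
    (h : ∀ i, p i → ∀ j, ¬ p j → K i j = 0) :
    (K.toSquareBlockProp p).charpoly ∣ K.charpoly := by
  refine ⟨(K.toSquareBlockProp fun i => ¬ p i).charpoly, ?_⟩
  have key : ∀ q : S → Prop, [DecidablePred q] →
      (K.charmatrix.toSquareBlockProp q) = (K.toSquareBlockProp q).charmatrix := by
    intro q _
    ext1 i j
    by_cases hij : i = j
    · subst hij
      simp [Matrix.toSquareBlockProp_def, Matrix.charmatrix_apply_eq]
    · have : (i : S) ≠ j := fun h => hij (Subtype.ext h)
      simp [Matrix.toSquareBlockProp_def, Matrix.charmatrix_apply_ne _ _ _ hij,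
        Matrix.charmatrix_apply_ne _ _ _ this]
  rw [Matrix.charpoly, Matrix.twoBlockTriangular_det' _ p, key, key]
  · rfl
  · intro i hi j hj
    have hij : i ≠ j := fun h => hj (h ▸ hi)
    rw [Matrix.charmatrix_apply_ne _ _ _ hij, h i hi j hj]
    simp

-- Reversibility makes the support of `π` closed, and conjugation by `√π` makes the block of `K` on
-- it symmetric, with fixed vector `√π`. The eigenvalues of that block form a sub-multiset of the
-- real roots for `K`, so any two of them have minimum at most `secondEigenvalue K`, even if `π`
-- vanishes somewhere.
open Matrix in
theorem dirichlet_le_of_sum_eq_zero {π : S → ℝ} (hπ : π ∈ stdSimplex ℝ S)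
    {K : Matrix S S ℝ} (hK_sum : ∀ i, ∑ j, K i j = 1)
    (hrev : ∀ i j, π i * K i j = π j * K j i) (hl : secondEigenvalue K < 1)
    {h : S → ℝ} (h0 : ∑ s, π s * h s = 0) :
    ∑ s, ∑ t, π s * K s t * h s * h t ≤ secondEigenvalue K * ∑ s, π s * h s ^ 2 := by
  classical
  set p : S → Prop := fun s => π s ≠ 0 with hp
  have hpos : ∀ s : {s // p s}, 0 < π s := fun s => lt_of_le_of_ne (hπ.1 s) s.2.symm
  have hsq : ∀ s : {s // p s}, √(π s) ≠ 0 := fun s => (Real.sqrt_pos.mpr (hpos s)).ne'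
  have hsqsq : ∀ s : {s // p s}, √(π s) * √(π s) = π s := fun s => Real.mul_self_sqrt (hpos s).le
  have hK0 : ∀ i, p i → ∀ j, ¬ p j → K i j = 0 := by
    intro i hi j hj
    have := hrev i j
    rw [not_not.mp hj, zero_mul] at this
    exact (mul_eq_zero.mp this).resolve_left hi
  have hsub : ∀ F : S → ℝ, (∀ s, ¬ p s → F s = 0) → ∑ s : {s // p s}, F s = ∑ s, F s := by
    intro F hF
    rw [← Fintype.sum_subtype_add_sum_subtype p F]
    simp [Finset.sum_eq_zero fun (s : {s // ¬ p s}) _ => hF s s.2]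
  set A : Matrix {s // p s} {s // p s} ℝ := fun s t => √(π s) * K s t / √(π t) with hAdef
  have hA1 : ∀ s t, A s t = √(π s) * K s t / √(π t) := fun _ _ => rfl
  have hA : A.IsHermitian := by
    ext s t
    have h1 := hrev s t
    rw [← hsqsq s, ← hsqsq t] at h1
    have h2 := hsq s
    have h3 := hsq t
    rw [Matrix.conjTranspose_apply, star_trivial, hA1, hA1]
    field_simp
    linarith
  have hchar : A.charpoly = (K.toSquareBlockProp p).charpoly := by
    have h1 : A = diagonal (fun s : {s // p s} => √(π s)) *
        (K.toSquareBlockProp p * diagonal (fun s : {s // p s} => (√(π s))⁻¹)) := by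
      ext s t
      simp [hAdef, Matrix.toSquareBlockProp_def, div_eq_mul_inv, mul_assoc]
    rw [h1, Matrix.charpoly_mul_comm, Matrix.mul_assoc, diagonal_mul_diagonal]
    simp [inv_mul_cancel₀ (hsq _)]
  have hroots : A.charpoly.roots ≤ K.charpoly.roots := by
    rw [hchar]
    exact Polynomial.roots.le_of_dvd K.charpoly_monic.ne_zero
      (charpoly_toSquareBlockProp_dvd K p hK0)
  have hmin : ∀ i j, i ≠ j →
      min (hA.eigenvalues i) (hA.eigenvalues j) ≤ secondEigenvalue K := by
    intro i j hij
    refine min_le_sort_getD_one _ (le_trans ?_ hroots)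
    rw [hA.roots_charpoly_eq_eigenvalues]
    have h1 : ({i, j} : Finset _).val ≤ Finset.univ.val :=
      Finset.val_le_iff.mpr (Finset.subset_univ _)
    have h2 := Multiset.map_le_map (f := (RCLike.ofReal ∘ hA.eigenvalues : _ → ℝ)) h1
    rwa [Finset.insert_val_of_notMem (by simpa using hij), Multiset.map_cons] at h2
  have hAe : A *ᵥ (fun s : {s // p s} => √(π s)) = fun s : {s // p s} => √(π s) := by
    ext s
    have h1 : ∀ t : {s // p s}, A s t * √(π t) = √(π s) * K s t := fun t =>
      div_mul_cancel₀ _ (hsq t)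
    simp only [mulVec, dotProduct, h1]
    rw [← Finset.mul_sum, hsub (fun t => K s t) (hK0 s s.2), hK_sum, mul_one]
  have he : (fun s : {s // p s} => √(π s)) ≠ 0 := by
    intro he
    have h1 : ∑ s, π s = 0 := by
      refine Finset.sum_eq_zero fun s _ => ?_
      by_contra hs
      exact hsq ⟨s, hs⟩ (congrFun he ⟨s, hs⟩)
    linarith [hπ.2]
  have hπ0 : ∀ s, ¬ p s → π s = 0 := fun s hs => not_not.mp hs
  have heh : (fun s : {s // p s} => √(π s)) ⬝ᵥ (fun s => √(π s) * h s) = 0 := by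
    simp only [dotProduct, ← mul_assoc, hsqsq]
    rw [hsub (fun s => π s * h s) fun s hs => by simp [hπ0 s hs], h0]
  have key := dotProduct_mulVec_le_of_forall_min_eigenvalues_le hA hl hmin he hAe heh
  have hrhs : ∑ s, π s * h s ^ 2 =
      (fun s : {s // p s} => √(π s) * h s) ⬝ᵥ (fun s => √(π s) * h s) := by
    rw [← hsub (fun s => π s * h s ^ 2) fun s hs => by simp [hπ0 s hs]]
    refine Finset.sum_congr rfl fun s _ => ?_
    rw [← hsqsq s]
    ring
  have hlhs : ∑ s, ∑ t, π s * K s t * h s * h t =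
      (fun s : {s // p s} => √(π s) * h s) ⬝ᵥ (A *ᵥ (fun s => √(π s) * h s)) := by
    rw [← hsub (fun s => ∑ t, π s * K s t * h s * h t) fun s hs => by simp [hπ0 s hs]]
    refine Finset.sum_congr rfl fun s _ => ?_
    rw [← hsub (fun t => π s * K s t * h s * h t) fun t ht => by simp [hK0 s s.2 t ht]]
    simp only [mulVec, dotProduct, Finset.mul_sum]
    refine Finset.sum_congr rfl fun t _ => ?_
    have h3 := hsq t
    have h4 : A s t * (√(π t) * h t) = √(π s) * K s t * h t := by
      rw [hA1]
      field_simp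
    rw [h4]
    linear_combination (-(K s t * h s * h t)) * hsqsq s
  rw [hrhs, hlhs]
  exact key


end SpectralGap

/-! ### Expectations of products along a path. -/

section Paths

variable {S : Type*} [Fintype S]

/-- The sum over all paths of length `k` started at `s` of the probability of the path times the
product of the weights `e i` of its points. -/
noncomputable def pathSum (K : Matrix S S ℝ) : ℕ → (ℕ → S → ℝ) → S → ℝ
  | 0, e => e 0
  | k + 1, e => fun s => e 0 s * ∑ t, K s t * pathSum K k (fun i => e (i + 1)) t

theorem sum_path_eq_sum_pathSum (K : Matrix S S ℝ) (k : ℕ) (π : S → ℝ) (e : ℕ → S → ℝ) :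
    ∑ x : Fin (k + 1) → S, (π (x 0) * ∏ j : Fin k, K (x j.castSucc) (x j.succ)) *
      ∏ j : Fin (k + 1), e j (x j) = ∑ s, π s * pathSum K k e s := by
  induction k generalizing π e with
  | zero =>
    rw [← (Equiv.funUnique (Fin 1) S).symm.sum_comp]
    simp [pathSum]
  | succ k ih =>
    have h1 := ih (fun t => ∑ s, π s * e 0 s * K s t) (fun i => e (i + 1))
    rw [← (Fin.consEquiv (fun _ => S)).sum_comp, Fintype.sum_prod_type]
    have h2 : ∑ s, π s * pathSum K (k + 1) e s =
        ∑ t, (∑ s, π s * e 0 s * K s t) * pathSum K k (fun i => e (i + 1)) t := by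
      simp only [pathSum, Finset.mul_sum, Finset.sum_mul]
      rw [Finset.sum_comm]
      exact Finset.sum_congr rfl fun _ _ => Finset.sum_congr rfl fun _ _ => by ring
    rw [h2, ← h1, Finset.sum_comm]
    refine Finset.sum_congr rfl fun x _ => ?_
    rw [Finset.sum_mul, Finset.sum_mul]
    refine Finset.sum_congr rfl fun s _ => ?_
    rw [Fin.prod_univ_succ (n := k), Fin.prod_univ_succ (n := k + 1)]
    simp only [Fin.consEquiv_apply, Fin.cons_zero, Fin.cons_succ, Fin.castSucc_zero,
      ← Fin.succ_castSucc, Fin.val_succ, Fin.val_zero]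
    ring

theorem sum_stationary {π : S → ℝ} {K : Matrix S S ℝ} (hK_sum : ∀ i, ∑ j, K i j = 1)
    (hrev : ∀ i j, π i * K i j = π j * K j i) (v : S → ℝ) :
    ∑ s, π s * ∑ t, K s t * v t = ∑ t, π t * v t := by
  simp only [Finset.mul_sum]
  rw [Finset.sum_comm]
  refine Finset.sum_congr rfl fun t _ => ?_
  simp only [← mul_assoc, hrev _ t]
  rw [← Finset.sum_mul, ← Finset.mul_sum, hK_sum, mul_one]

theorem pathSum_one {K : Matrix S S ℝ} (hK_sum : ∀ i, ∑ j, K i j = 1) (k : ℕ) :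
    pathSum K k (fun _ _ => 1) = fun _ => 1 := by
  induction k with
  | zero => rfl
  | succ k ih => funext s; simp [pathSum, ih, hK_sum]

theorem sum_pathSum_single {π : S → ℝ} {K : Matrix S S ℝ} (hK_sum : ∀ i, ∑ j, K i j = 1)
    (hrev : ∀ i j, π i * K i j = π j * K j i) (φ : S → ℝ) {k j : ℕ} (hj : j ≤ k) :
    ∑ s, π s * pathSum K k (fun i s => if i = j then φ s else 1) s = ∑ s, π s * φ s := by
  induction k generalizing j with
  | zero =>
    obtain rfl : j = 0 := by omega
    simp [pathSum]
  | succ k ih =>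
    cases j with
    | zero => simp [pathSum, pathSum_one hK_sum, hK_sum]
    | succ j =>
      simp only [pathSum, Nat.add_right_cancel_iff]
      rw [← ih (by omega : j ≤ k)]
      simpa using sum_stationary hK_sum hrev _

/-! ### Quadratic forms and the exponentially tilted kernel. -/

section Form

variable {π : S → ℝ} {K : Matrix S S ℝ} {ρ : ℝ} {w : S → ℝ}

/-- Polarisation. The term in `u - v` needs a lower bound on the form; since `K` has nonnegative
entries, the upper bound at `|u - v|` supplies it. Very negative eigenvalues therefore do no harm.
-/
theorem two_mul_form_le (hπ : ∀ s, 0 ≤ π s) (hK : ∀ i j, 0 ≤ K i j)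
    (hrev : ∀ i j, π i * K i j = π j * K j i)
    (hform : ∀ h : S → ℝ, ∑ s, ∑ t, π s * K s t * h s * h t ≤ ρ * ∑ s, π s * h s ^ 2 / w s)
    (u v : S → ℝ) :
    2 * ∑ s, ∑ t, π s * K s t * u s * v t ≤
      ρ * (∑ s, π s * u s ^ 2 / w s + ∑ s, π s * v s ^ 2 / w s) := by
  have h1 := hform (fun s => u s + v s)
  have h2 := hform (fun s => |u s - v s|)
  simp only [sq_abs] at h2
  have h3 : -∑ s, ∑ t, π s * K s t * (u s - v s) * (u t - v t) ≤
      ∑ s, ∑ t, π s * K s t * |u s - v s| * |u t - v t| := by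
    simp only [← Finset.sum_neg_distrib]
    refine Finset.sum_le_sum fun s _ => Finset.sum_le_sum fun t _ => ?_
    have := mul_le_mul_of_nonneg_left (neg_abs_le ((u s - v s) * (u t - v t)))
      (mul_nonneg (hπ s) (hK s t))
    rw [abs_mul] at this
    linarith
  have h4 : ∑ s, ∑ t, π s * K s t * v s * u t = ∑ s, ∑ t, π s * K s t * u s * v t := by
    rw [Finset.sum_comm]
    refine Finset.sum_congr rfl fun s _ => Finset.sum_congr rfl fun t _ => ?_
    rw [hrev t s]
    ring
  have h5 : ∑ s, ∑ t, π s * K s t * (u s + v s) * (u t + v t) -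
      ∑ s, ∑ t, π s * K s t * (u s - v s) * (u t - v t) =
      2 * (∑ s, ∑ t, π s * K s t * u s * v t) + 2 * ∑ s, ∑ t, π s * K s t * v s * u t := by
    simp only [Finset.mul_sum, ← Finset.sum_sub_distrib, ← Finset.sum_add_distrib]
    exact Finset.sum_congr rfl fun s _ => Finset.sum_congr rfl fun t _ => by ring
  have h6 : ∑ s, π s * (u s + v s) ^ 2 / w s + ∑ s, π s * (u s - v s) ^ 2 / w s =
      2 * (∑ s, π s * u s ^ 2 / w s + ∑ s, π s * v s ^ 2 / w s) := by
    simp only [Finset.mul_sum, ← Finset.sum_add_distrib]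
    exact Finset.sum_congr rfl fun s _ => by ring
  rw [h4] at h5
  have h7 : ρ * ∑ s, π s * (u s + v s) ^ 2 / w s + ρ * ∑ s, π s * (u s - v s) ^ 2 / w s =
      2 * (ρ * (∑ s, π s * u s ^ 2 / w s + ∑ s, π s * v s ^ 2 / w s)) := by
    rw [← mul_add, h6]; ring
  linarith

/-- The path sums satisfy `v (k + 1) = w · K (v k)`. In the norm `∑ π v² / w` this map has norm at
most `ρ`, and Cauchy–Schwarz against `w` returns to the plain sum. -/
theorem sum_pathSum_const_le (hπ : ∀ s, 0 ≤ π s) (hK : ∀ i j, 0 ≤ K i j)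
    (hrev : ∀ i j, π i * K i j = π j * K j i) (hρ : 0 < ρ) (hw : ∀ s, 0 < w s)
    (hform : ∀ h : S → ℝ, ∑ s, ∑ t, π s * K s t * h s * h t ≤ ρ * ∑ s, π s * h s ^ 2 / w s)
    (k : ℕ) :
    ∑ s, π s * pathSum K k (fun _ => w) s ≤ ρ ^ k * ∑ s, π s * w s := by
  set v : ℕ → S → ℝ := fun k => pathSum K k (fun _ => w) with hv
  have hw' : ∀ s, w s ≠ 0 := fun s => (hw s).ne'
  have hstep : ∀ (z : S → ℝ) k, ∑ s, π s * z s * v (k + 1) s / w s =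
      ∑ s, ∑ t, π s * K s t * z s * v k t := by
    intro z k
    refine Finset.sum_congr rfl fun s _ => ?_
    have : v (k + 1) s = w s * ∑ t, K s t * v k t := rfl
    rw [this, mul_div_assoc, mul_div_cancel_left₀ _ (hw' s), Finset.mul_sum]
    exact Finset.sum_congr rfl fun t _ => by ring
  have hnorm : ∀ k, ∑ s, π s * v k s ^ 2 / w s ≤ (ρ ^ k) ^ 2 * ∑ s, π s * w s := by
    intro k
    induction k with
    | zero =>
      refine le_of_eq ?_
      rw [pow_zero, one_pow, one_mul]
      refine Finset.sum_congr rfl fun s _ => ?_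
      have : v 0 s = w s := rfl
      rw [this]
      have := hw' s
      field_simp
    | succ k ih =>
      -- The factor `ρ` on `v k` balances the two squares, so that half of the left side absorbs the
      -- first of them.
      have h1 := two_mul_form_le hπ hK hrev hform (v (k + 1)) (fun s => ρ * v k s)
      have h2 : ∑ s, ∑ t, π s * K s t * v (k + 1) s * (ρ * v k t) =
          ρ * ∑ s, π s * v (k + 1) s ^ 2 / w s := by
        have := hstep (v (k + 1)) k
        simp only [mul_assoc, ← sq] at this
        simp only [mul_assoc]
        rw [this]
        simp only [Finset.mul_sum]
        exact Finset.sum_congr rfl fun s _ => Finset.sum_congr rfl fun t _ => by ring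
      have h3 : ∑ s, π s * (ρ * v k s) ^ 2 / w s = ρ ^ 2 * ∑ s, π s * v k s ^ 2 / w s := by
        rw [Finset.mul_sum]
        exact Finset.sum_congr rfl fun s _ => by ring
      rw [h2, h3] at h1
      have h4 : ∑ s, π s * v (k + 1) s ^ 2 / w s ≤ ρ ^ 2 * ∑ s, π s * v k s ^ 2 / w s := by
        have : ρ * (2 * ∑ s, π s * v (k + 1) s ^ 2 / w s) ≤ ρ * (∑ s, π s * v (k + 1) s ^ 2 / w s +
          ρ ^ 2 * ∑ s, π s * v k s ^ 2 / w s) := by linarith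
        linarith [le_of_mul_le_mul_left this hρ]
      calc _ ≤ _ := h4
        _ ≤ ρ ^ 2 * ((ρ ^ k) ^ 2 * ∑ s, π s * w s) := by gcongr
        _ = _ := by ring
  have hk : 0 < ρ ^ k := pow_pos hρ k
  -- Cauchy–Schwarz in its arithmetic–geometric form, with weight `ρ ^ k`.
  have hsq : ∀ s, 2 * ρ ^ k * (π s * v k s) ≤
      (ρ ^ k) ^ 2 * (π s * w s) + π s * v k s ^ 2 / w s := by
    intro s
    have h1 : 0 ≤ π s * (ρ ^ k * w s - v k s) ^ 2 / w s :=
      div_nonneg (mul_nonneg (hπ s) (sq_nonneg _)) (hw s).le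
    have h2 : π s * (ρ ^ k * w s - v k s) ^ 2 / w s = (ρ ^ k) ^ 2 * (π s * w s) +
        π s * v k s ^ 2 / w s - 2 * ρ ^ k * (π s * v k s) := by
      have := hw' s
      field_simp
      ring
    linarith
  have hsum := Finset.sum_le_sum fun s (_ : s ∈ Finset.univ) => hsq s
  rw [Finset.sum_add_distrib, ← Finset.mul_sum, ← Finset.mul_sum] at hsum
  have h1 : (2 * ρ ^ k) * ∑ s, π s * v k s ≤ (2 * ρ ^ k) * (ρ ^ k * ∑ s, π s * w s) := by
    linarith [hnorm k]
  exact le_of_mul_le_mul_left h1 (by positivity)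

end Form

/-- Bound the tilt below by `exp x ≥ 1 + x` at `x = c - θ f`, and split `h` into its mean `a` and
the rest. The term `θ f a²` averages to zero; the cross term costs `c a²` plus `δ/3` of the
variance, the quadratic term another `δ/6`. The total `δ/2` is within the available `δ`. -/
theorem form_le_exp_mul {π : S → ℝ} (hπ : π ∈ stdSimplex ℝ S) {f : S → ℝ} (hf : ∀ s, |f s| ≤ 1)
    (hf0 : ∑ s, π s * f s = 0) {δ θ : ℝ} (hδ : 0 < δ) (hθ : 0 ≤ θ) (hθδ : 6 * θ ≤ δ)
    (h : S → ℝ) :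
    (∑ s, π s * h s) ^ 2 + (1 - δ) * (∑ s, π s * h s ^ 2 - (∑ s, π s * h s) ^ 2) ≤
      Real.exp (3 * θ ^ 2 / δ) * ∑ s, π s * h s ^ 2 / Real.exp (θ * f s) := by
  set a := ∑ s, π s * h s with ha
  set c := 3 * θ ^ 2 / δ with hc
  have hcδ : c * δ = 3 * θ ^ 2 := by rw [hc]; field_simp
  have h1 : ∀ s, π s * (θ * f s * a ^ 2 + c * a ^ 2 + δ / 2 * (h s - a) ^ 2) ≥
      π s * (θ * f s * h s ^ 2) := by
    intro s
    refine mul_le_mul_of_nonneg_left ?_ (hπ.1 s)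
    obtain ⟨hf1, hf2⟩ := abs_le.mp (hf s)
    have h2 : 2 * θ * a * f s * (h s - a) ≤ c * a ^ 2 + δ / 3 * (h s - a) ^ 2 := by
      have h3 : (f s) ^ 2 ≤ 1 := by nlinarith
      have h4 : δ * (2 * θ * a * f s * (h s - a)) ≤
          δ * (c * a ^ 2 + δ / 3 * (h s - a) ^ 2) := by
        have h5 : δ * (c * a ^ 2 + δ / 3 * (h s - a) ^ 2) =
            3 * (θ * a) ^ 2 + (δ * (h s - a)) ^ 2 / 3 := by
          linear_combination a ^ 2 * hcδ
        rw [h5]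
        nlinarith [sq_nonneg (3 * (θ * a * f s) - δ * (h s - a)),
          mul_le_mul_of_nonneg_left h3 (sq_nonneg (θ * a))]
      exact le_of_mul_le_mul_left h4 hδ
    have h3 : θ * f s * (h s - a) ^ 2 ≤ δ / 6 * (h s - a) ^ 2 := by
      refine mul_le_mul_of_nonneg_right ?_ (sq_nonneg _)
      nlinarith
    linarith [show θ * f s * h s ^ 2 = θ * f s * a ^ 2 + 2 * θ * a * f s * (h s - a) +
      θ * f s * (h s - a) ^ 2 by ring]
  have h2 : ∀ s, π s * ((1 + c - θ * f s) * h s ^ 2) ≤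
      Real.exp c * (π s * h s ^ 2 / Real.exp (θ * f s)) := by
    intro s
    have h3 : Real.exp c * (π s * h s ^ 2 / Real.exp (θ * f s)) =
        π s * (Real.exp (c - θ * f s) * h s ^ 2) := by
      rw [Real.exp_sub]; ring
    rw [h3]
    refine mul_le_mul_of_nonneg_left (mul_le_mul_of_nonneg_right ?_ (sq_nonneg _)) (hπ.1 s)
    linarith [Real.add_one_le_exp (c - θ * f s)]
  have h3 := Finset.sum_le_sum fun s (_ : s ∈ Finset.univ) => h1 s
  have h4 := Finset.sum_le_sum fun s (_ : s ∈ Finset.univ) => h2 s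
  rw [← Finset.mul_sum] at h4
  refine le_trans ?_ h4
  have e1 : ∑ s, π s * (θ * f s * a ^ 2 + c * a ^ 2 + δ / 2 * (h s - a) ^ 2) =
      c * a ^ 2 + δ / 2 * (∑ s, π s * h s ^ 2 - a ^ 2) := by
    have : ∀ s, π s * (θ * f s * a ^ 2 + c * a ^ 2 + δ / 2 * (h s - a) ^ 2) =
        θ * a ^ 2 * (π s * f s) + (c * a ^ 2 + δ / 2 * a ^ 2) * π s +
          δ / 2 * (π s * h s ^ 2) - δ * a * (π s * h s) := fun s => by ring
    simp only [this, Finset.sum_add_distrib, Finset.sum_sub_distrib, ← Finset.mul_sum, hf0, hπ.2,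
      ← ha]
    ring
  have e2 : ∑ s, π s * ((1 + c - θ * f s) * h s ^ 2) =
      (1 + c) * ∑ s, π s * h s ^ 2 - ∑ s, π s * (θ * f s * h s ^ 2) := by
    rw [Finset.mul_sum, ← Finset.sum_sub_distrib]
    exact Finset.sum_congr rfl fun s _ => by ring
  have hV : 0 ≤ ∑ s, π s * h s ^ 2 - a ^ 2 := by
    have : ∑ s, π s * h s ^ 2 - a ^ 2 = ∑ s, π s * (h s - a) ^ 2 := by
      have : ∀ s, π s * (h s - a) ^ 2 = π s * h s ^ 2 - 2 * a * (π s * h s) + a ^ 2 * π s :=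
        fun s => by ring
      simp only [this, Finset.sum_add_distrib, Finset.sum_sub_distrib, ← Finset.mul_sum, hπ.2,
        ← ha]
      ring
    rw [this]
    exact Finset.sum_nonneg fun s _ => mul_nonneg (hπ.1 s) (sq_nonneg _)
  rw [e1] at h3
  rw [e2]
  have hc0 : 0 ≤ c := by positivity
  nlinarith [mul_nonneg hc0 hV, mul_nonneg hδ.le hV]

theorem form_le_of_secondEigenvalue_lt_one [DecidableEq S] {π : S → ℝ} (hπ : π ∈ stdSimplex ℝ S)
    {K : Matrix S S ℝ} (hK_sum : ∀ i, ∑ j, K i j = 1)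
    (hrev : ∀ i j, π i * K i j = π j * K j i) (hl : secondEigenvalue K < 1) (h : S → ℝ) :
    ∑ s, ∑ t, π s * K s t * h s * h t ≤ (∑ s, π s * h s) ^ 2 +
      secondEigenvalue K * (∑ s, π s * h s ^ 2 - (∑ s, π s * h s) ^ 2) := by
  set a := ∑ s, π s * h s with ha
  have h0 : ∑ s, π s * (h s - a) = 0 := by
    simp only [mul_sub, Finset.sum_sub_distrib, ← Finset.sum_mul, hπ.2, ← ha]
    ring
  have key := dirichlet_le_of_sum_eq_zero hπ hK_sum hrev hl h0
  have e1 : ∑ s, π s * (h s - a) ^ 2 = ∑ s, π s * h s ^ 2 - a ^ 2 := by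
    have : ∀ s, π s * (h s - a) ^ 2 = π s * h s ^ 2 - 2 * a * (π s * h s) + a ^ 2 * π s :=
      fun s => by ring
    simp only [this, Finset.sum_add_distrib, Finset.sum_sub_distrib, ← Finset.mul_sum, hπ.2, ← ha]
    ring
  have e2 : ∑ s, ∑ t, π s * K s t * (h s - a) * (h t - a) =
      ∑ s, ∑ t, π s * K s t * h s * h t - a ^ 2 := by
    have h1 : ∀ s t, π s * K s t * (h s - a) * (h t - a) =
        π s * K s t * h s * h t - a * (π s * h s) * K s t -
          a * (π s * (K s t * h t)) + a ^ 2 * π s * K s t := fun s t => by ring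
    simp only [h1, Finset.sum_add_distrib, Finset.sum_sub_distrib, ← Finset.mul_sum, hK_sum,
      mul_one, hπ.2, sum_stationary hK_sum hrev, ← ha]
    ring
  rw [e1, e2] at key
  linarith


/-- Gershgorin: row `k` has centre `K k k` and radius `1 - K k k`. The default value `-1` also
complies. -/
theorem neg_one_le_secondEigenvalue [DecidableEq S] {K : Matrix S S ℝ}
    (hK_nonneg : ∀ i j, 0 ≤ K i j) (hK_sum : ∀ i, ∑ j, K i j = 1) :
    -1 ≤ secondEigenvalue K := by
  have key : ∀ μ ∈ K.charpoly.roots, -1 ≤ μ := by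
    intro μ hμ
    have h1 : Module.End.HasEigenvalue (Matrix.toLin' K) μ := by
      rw [Module.End.hasEigenvalue_iff_isRoot_charpoly, Matrix.charpoly_toLin']
      exact Polynomial.isRoot_of_mem_roots hμ
    obtain ⟨k, hk⟩ := eigenvalue_mem_ball h1
    rw [Metric.mem_closedBall, Real.dist_eq] at hk
    have h2 : ∑ j ∈ Finset.univ.erase k, ‖K k j‖ = 1 - K k k := by
      rw [← hK_sum k, ← Finset.add_sum_erase _ _ (Finset.mem_univ k), add_sub_cancel_left]
      exact Finset.sum_congr rfl fun j _ => Real.norm_of_nonneg (hK_nonneg k j)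
    rw [h2] at hk
    linarith [(abs_le.mp hk).1, hK_nonneg k k]
  rw [secondEigenvalue, List.getD_eq_getElem?_getD]
  rcases h : (K.charpoly.roots.sort (· ≥ ·))[1]? with _ | μ
  · simp
  · exact key μ ((Multiset.mem_sort (r := (· ≥ ·))).mp (List.mem_of_getElem? h))

/-! ### Chernoff bound for one stationary chain. -/

section Chain

variable [MeasurableSpace S] [MeasurableSingletonClass S]
  {Ω : Type*} [MeasurableSpace Ω] {P : Measure Ω} [IsProbabilityMeasure P]
  {π : S → ℝ} {K : Matrix S S ℝ} {m : ℕ} {hm : 1 ≤ m} {X : Fin m → Ω → S}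

omit [Fintype S] [MeasurableSingletonClass S] [IsProbabilityMeasure P] in
theorem IsChain.measurable_path (hX : IsChain P π K hm X) : Measurable fun ω j => X j ω :=
  measurable_pi_lambda _ hX.measurable

theorem IsChain.integrable (hX : IsChain P π K hm X) (F : (Fin m → S) → ℝ) :
    Integrable (fun ω => F fun j => X j ω) P := by
  classical
  have := Measure.isProbabilityMeasure_map (μ := P) hX.measurable_path.aemeasurable
  exact (Integrable.of_finite (μ := P.map fun ω j => X j ω) (f := F)).comp_measurable
    hX.measurable_path

theorem IsChain.integral_eq [DecidableEq S] (hX : IsChain P π K hm X) (hπ : ∀ s, 0 ≤ π s)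
    (hK : ∀ i j, 0 ≤ K i j) (F : (Fin m → S) → ℝ) :
    ∫ ω, F (fun j => X j ω) ∂P = ∑ x, pathProb π K hm x * F x := by
  have := Measure.isProbabilityMeasure_map (μ := P) hX.measurable_path.aemeasurable
  have hF : Measurable F := measurable_of_finite F
  rw [← integral_map (f := F) hX.measurable_path.aemeasurable hF.aestronglyMeasurable,
    integral_fintype Integrable.of_finite]
  refine Finset.sum_congr rfl fun x _ => ?_
  have h1 : (fun ω j => X j ω) ⁻¹' {x} = {ω | ∀ j, X j ω = x j} := by
    ext ω
    simp [funext_iff]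
  rw [map_measureReal_apply hX.measurable_path (measurableSet_singleton x), h1, measureReal_def,
    hX.law, ENNReal.toReal_ofReal, smul_eq_mul]
  exact mul_nonneg (hπ _) (Finset.prod_nonneg fun _ _ => hK _ _)

theorem IsChain.integral_prod [DecidableEq S] (hX : IsChain P π K hm X) (hπ : ∀ s, 0 ≤ π s)
    (hK : ∀ i j, 0 ≤ K i j) (e : ℕ → S → ℝ) :
    ∫ ω, ∏ j : Fin m, e j (X j ω) ∂P = ∑ s, π s * pathSum K (m - 1) e s := by
  rw [hX.integral_eq hπ hK (fun x => ∏ j : Fin m, e j (x j))]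
  obtain ⟨k, rfl⟩ : ∃ k, m = k + 1 := ⟨m - 1, by omega⟩
  exact sum_path_eq_sum_pathSum K k π e

theorem IsChain.integral_apply [DecidableEq S] (hX : IsChain P π K hm X) (hπ : ∀ s, 0 ≤ π s)
    (hK : ∀ i j, 0 ≤ K i j) (hK_sum : ∀ i, ∑ j, K i j = 1)
    (hrev : ∀ i j, π i * K i j = π j * K j i) (g : S → ℝ) (j : Fin m) :
    ∫ ω, g (X j ω) ∂P = ∑ s, π s * g s := by
  rw [← sum_pathSum_single hK_sum hrev g (show (j : ℕ) ≤ m - 1 by omega),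
    ← hX.integral_prod hπ hK]
  congr 1
  funext ω
  simp [Fin.val_inj]

theorem IsChain.integral_avg [DecidableEq S] (hX : IsChain P π K hm X) (hπ : ∀ s, 0 ≤ π s)
    (hK : ∀ i j, 0 ≤ K i j) (hK_sum : ∀ i, ∑ j, K i j = 1)
    (hrev : ∀ i j, π i * K i j = π j * K j i) (g : S → ℝ) :
    ∫ ω, (∑ j, g (X j ω)) / m ∂P = ∑ s, π s * g s := by
  have hm0 : (m : ℝ) ≠ 0 := by positivity
  rw [integral_div, integral_finsetSum _ fun j _ => hX.integrable fun x => g (x j)]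
  simp only [hX.integral_apply hπ hK hK_sum hrev, Finset.sum_const, Finset.card_univ,
    Fintype.card_fin, nsmul_eq_mul]
  field_simp

theorem IsChain.measureReal_mul_le_sum_le [DecidableEq S] (hX : IsChain P π K hm X)
    (hπ : π ∈ stdSimplex ℝ S) (hK : ∀ i j, 0 ≤ K i j) (hK_sum : ∀ i, ∑ j, K i j = 1)
    (hrev : ∀ i j, π i * K i j = π j * K j i) (hl : secondEigenvalue K < 1)
    {f : S → ℝ} (hf : ∀ s, |f s| ≤ 1) (hf0 : ∑ s, π s * f s = 0)
    {ε : ℝ} (hε0 : 0 ≤ ε) (hε1 : ε ≤ 1) :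
    P.real {ω | m * ε ≤ ∑ j, f (X j ω)} ≤
      3 * Real.exp (-(m * ε ^ 2 * (1 - secondEigenvalue K) / 12)) := by
  set δ := 1 - secondEigenvalue K with hδ
  have hδ0 : 0 < δ := by linarith
  have hδ2 : δ ≤ 2 := by linarith [neg_one_le_secondEigenvalue hK hK_sum]
  -- The minimiser of the exponent `-θ ε + 3 θ² / δ`, with minimum `-ε² δ / 12`.
  set θ := ε * δ / 6 with hθ
  have hθ0 : 0 ≤ θ := by positivity
  have hθδ : 6 * θ ≤ δ := by
    rw [hθ]; nlinarith
  set ρ := Real.exp (3 * θ ^ 2 / δ) with hρ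
  have hform : ∀ h : S → ℝ, ∑ s, ∑ t, π s * K s t * h s * h t ≤
      ρ * ∑ s, π s * h s ^ 2 / Real.exp (θ * f s) := fun h =>
    (form_le_of_secondEigenvalue_lt_one hπ hK_sum hrev hl h).trans (by
      have := form_le_exp_mul hπ hf hf0 hδ0 hθ0 hθδ h
      rwa [hδ, sub_sub_cancel] at this)
  have h1 := measure_ge_le_exp_mul_mgf (μ := P) (X := fun ω => ∑ j, f (X j ω)) (m * ε) hθ0
    (hX.integrable fun x => Real.exp (θ * ∑ j, f (x j)))
  have h2 : mgf (fun ω => ∑ j, f (X j ω)) P θ =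
      ∑ s, π s * pathSum K (m - 1) (fun _ s => Real.exp (θ * f s)) s := by
    rw [← hX.integral_prod hπ.1 hK, mgf]
    simp only [Finset.mul_sum, Real.exp_sum]
  have h3 := sum_pathSum_const_le (w := fun s => Real.exp (θ * f s)) hπ.1 hK hrev
    (Real.exp_pos _) (fun s => Real.exp_pos _) hform (m - 1)
  -- A path of `m` points has only `m - 1` steps; the leftover factor is at most `3`, because `δ ≤
  -- 2` forces `θ ≤ 1/3`.
  have h4 : ∑ s, π s * Real.exp (θ * f s) ≤ 3 := by
    calc ∑ s, π s * Real.exp (θ * f s) ≤ ∑ s, π s * 3 := by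
          refine Finset.sum_le_sum fun s _ => mul_le_mul_of_nonneg_left ?_ (hπ.1 s)
          refine le_trans (Real.exp_le_exp.mpr ?_) Real.exp_one_lt_three.le
          nlinarith [(abs_le.mp (hf s)).2]
      _ = 3 := by rw [← Finset.sum_mul, hπ.2, one_mul]
  have h5 : ρ ^ (m - 1) ≤ ρ ^ m :=
    pow_le_pow_right₀ (Real.one_le_exp (by positivity)) (Nat.sub_le _ _)
  calc _ ≤ _ := h1
    _ ≤ Real.exp (-θ * (m * ε)) * (ρ ^ m * 3) := by
        rw [h2]
        refine mul_le_mul_of_nonneg_left (h3.trans ?_) (Real.exp_pos _).le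
        exact mul_le_mul h5 h4 (Finset.sum_nonneg fun s _ => mul_nonneg (hπ.1 s) (Real.exp_pos _).le)
          (by positivity)
    _ = 3 * (Real.exp (-θ * (m * ε) + m * (3 * θ ^ 2 / δ))) := by
        rw [hρ, ← Real.exp_nat_mul, Real.exp_add]; ring
    _ = _ := by
        congr 2
        rw [hθ]
        field_simp
        ring

theorem IsChain.measureReal_lt_abs_avg_sub_le [DecidableEq S] (hX : IsChain P π K hm X)
    (hπ : π ∈ stdSimplex ℝ S) (hK : ∀ i j, 0 ≤ K i j) (hK_sum : ∀ i, ∑ j, K i j = 1)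
    (hrev : ∀ i j, π i * K i j = π j * K j i) (hl : secondEigenvalue K < 1)
    {g : S → ℝ} (hg : ∀ s, 0 ≤ g s ∧ g s ≤ 1) {ε : ℝ} (hε0 : 0 ≤ ε) (hε1 : ε ≤ 1) :
    P.real {ω | ε < |(∑ j, g (X j ω)) / m - ∑ s, π s * g s|} ≤
      6 * Real.exp (-(m * ε ^ 2 * (1 - secondEigenvalue K) / 12)) := by
  set a := ∑ s, π s * g s with ha
  have hm0 : (0 : ℝ) < m := by exact_mod_cast hm
  have ha0 : 0 ≤ a := Finset.sum_nonneg fun s _ => mul_nonneg (hπ.1 s) (hg s).1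
  have ha1 : a ≤ 1 := by
    rw [← hπ.2]
    exact Finset.sum_le_sum fun s _ => mul_le_of_le_one_right (hπ.1 s) (hg s).2
  have hf : ∀ s, |g s - a| ≤ 1 := fun s => abs_le.mpr
    ⟨by linarith [(hg s).1], by linarith [(hg s).2]⟩
  have hf0 : ∑ s, π s * (g s - a) = 0 := by
    simp only [mul_sub, Finset.sum_sub_distrib, ← Finset.sum_mul, hπ.2, ← ha]
    ring
  have h1 := hX.measureReal_mul_le_sum_le hπ hK hK_sum hrev hl hf hf0 hε0 hε1
  have h2 := hX.measureReal_mul_le_sum_le hπ hK hK_sum hrev hl (f := fun s => -(g s - a))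
    (fun s => (abs_neg (g s - a)).trans_le (hf s))
    (by simp only [mul_neg, Finset.sum_neg_distrib, hf0, neg_zero]) hε0 hε1
  have hsub : {ω | ε < |(∑ j, g (X j ω)) / m - a|} ⊆
      {ω | m * ε ≤ ∑ j, (g (X j ω) - a)} ∪ {ω | m * ε ≤ ∑ j, -(g (X j ω) - a)} := by
    intro ω hω
    have h3 : ∑ j, (g (X j ω) - a) = m * ((∑ j, g (X j ω)) / m - a) := by
      rw [Finset.sum_sub_distrib, mul_sub, mul_div_cancel₀ _ hm0.ne']
      simp
    simp only [Set.mem_union, Set.mem_ofPred_eq, Finset.sum_neg_distrib, h3, ← mul_neg]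
    exact (lt_abs.mp hω).imp (fun h => mul_le_mul_of_nonneg_left h.le hm0.le)
      fun h => mul_le_mul_of_nonneg_left h.le hm0.le
  calc _ ≤ _ := measureReal_mono hsub
    _ ≤ _ := measureReal_union_le _ _
    _ ≤ _ := by linarith

end Chain

end Paths


/-! ### Truncated means of independent bounded variables. -/

theorem measureReal_le_abs_sum_sub_le {Ω : Type*} [MeasurableSpace Ω] {P : Measure Ω}
    [IsProbabilityMeasure P] {n : ℕ} {Y : Fin n → Ω → ℝ} (hY : ∀ i, Measurable (Y i))
    (hindep : iIndepFun Y P) {u v : ℝ} (huv : ∀ i ω, Y i ω ∈ Set.Icc u v) {c : ℝ} (hc : 0 < c) :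
    P.real {ω | c ≤ |∑ i, Y i ω - ∑ i, ∫ ω, Y i ω ∂P|} ≤ n * ((v - u) / 2) ^ 2 / c ^ 2 := by
  have hL : ∀ i, MemLp (Y i) 2 P := fun i =>
    memLp_of_bounded (Filter.Eventually.of_forall (huv i)) (hY i).aestronglyMeasurable 2
  have h1 := meas_ge_le_variance_div_sq (memLp_finsetSum' Finset.univ fun i _ => hL i) hc
  rw [IndepFun.variance_sum (fun i _ => hL i) fun i _ j _ hij => hindep.indepFun hij] at h1
  simp only [Finset.sum_apply] at h1
  rw [integral_finsetSum _ fun i _ => (hL i).integrable (by norm_num)] at h1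
  have h2 : ∑ i, Var[Y i; P] ≤ n * ((v - u) / 2) ^ 2 := by
    calc ∑ i, Var[Y i; P] ≤ ∑ _i : Fin n, ((v - u) / 2) ^ 2 :=
          Finset.sum_le_sum fun i _ => variance_le_sq_of_bounded
            (Filter.Eventually.of_forall (huv i)) (hY i).aemeasurable
      _ = _ := by simp
  calc _ ≤ (∑ i, Var[Y i; P]) / c ^ 2 := by
        refine ENNReal.toReal_le_of_le_ofReal ?_ h1
        exact div_nonneg (Finset.sum_nonneg fun i _ => variance_nonneg _ _) (sq_nonneg _)
    _ ≤ _ := by gcongr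

theorem measureReal_forall_notMem_le {Ω : Type*} [MeasurableSpace Ω] {P : Measure Ω}
    [IsProbabilityMeasure P] {n : ℕ} {Y : Fin n → Ω → ℝ} (hY : ∀ i, Measurable (Y i))
    (hindep : iIndepFun Y P) {B : Set ℝ} (hB : MeasurableSet B) :
    P.real {ω | ∀ i, Y i ω ∉ B} ≤ Real.exp (-∑ i, P.real (Y i ⁻¹' B)) := by
  have h1 := hindep.measure_inter_preimage_eq_mul Finset.univ (sets := fun _ => Bᶜ)
    fun _ _ => hB.compl
  have h2 : {ω | ∀ i, Y i ω ∉ B} = ⋂ i ∈ Finset.univ, Y i ⁻¹' Bᶜ := by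
    ext ω; simp
  rw [measureReal_def, h2, h1, ENNReal.toReal_prod, ← Finset.sum_neg_distrib, Real.exp_sum]
  refine Finset.prod_le_prod (fun _ _ => ENNReal.toReal_nonneg) fun i _ => ?_
  rw [← measureReal_def, Set.preimage_compl, probReal_compl_eq_one_sub (hY i hB)]
  linarith [Real.add_one_le_exp (-P.real (Y i ⁻¹' B))]

open Classical in
theorem measureReal_truncation_le {Ω : Type*} [MeasurableSpace Ω] {P : Measure Ω}
    [IsProbabilityMeasure P] {n : ℕ} (hn : 0 < n) {A : Fin n → Ω → ℝ}
    (hA : ∀ i, Measurable (A i)) (hindep : iIndepFun A P) (hA01 : ∀ i ω, A i ω ∈ Set.Icc 0 1)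
    {a : ℝ} (hAa : ∀ i, ∫ ω, A i ω ∂P = a) {b d α : ℝ} (hb : b ∈ Set.Icc (0 : ℝ) 1)
    (hd : 0 < d) (hα : 0 < α) {T : ℝ → ℝ} (hT : ∀ x, T x = if |x - b| ≤ d then x else b) :
    P.real {ω | √(2 / α) * (d / √n) +
        truncWidth (Finset.univ.filter fun i => A i ω ≠ T (A i ω)).card n (α / 2) <
        |(∑ i, T (A i ω)) / n - a|} ≤ α := by
  have hn0 : (0 : ℝ) < n := by exact_mod_cast hn
  have hsn : 0 < √(n : ℝ) := Real.sqrt_pos.mpr hn0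
  have hsn2 : √(n : ℝ) ^ 2 = n := Real.sq_sqrt hn0.le
  have hsα : 0 < √α := Real.sqrt_pos.mpr hα
  have hsα2 : √α ^ 2 = α := Real.sq_sqrt hα.le
  have hs2α : 0 < √(2 / α) := Real.sqrt_pos.mpr (by positivity)
  have hs2α2 : √(2 / α) ^ 2 = 2 / α := Real.sq_sqrt (by positivity)
  have hTm : Measurable T := by
    rw [funext hT]
    exact Measurable.ite (measurableSet_le (by fun_prop) measurable_const) measurable_id
      measurable_const
  set B : Set ℝ := {x | x ≠ T x} with hB
  have hBm : MeasurableSet B := (measurableSet_eq_fun measurable_id hTm).compl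
  set z : ℝ → ℝ := B.indicator 1 with hz
  have hzm : Measurable z := measurable_one.indicator hBm
  set q : Fin n → ℝ := fun i => P.real (A i ⁻¹' B) with hq
  have hzq : ∀ i, ∫ ω, z (A i ω) ∂P = q i := by
    intro i
    have : (fun ω => z (A i ω)) = (A i ⁻¹' B).indicator 1 := by
      ext ω
      simp [hz, Set.indicator_apply]
    rw [this, integral_indicator_one (hA i hBm)]
  have hz01 : ∀ x, z x ∈ Set.Icc (0 : ℝ) 1 := by
    intro x
    by_cases hx : x ∈ B <;> simp [hz, hx]
  have hN : ∀ ω, (((Finset.univ.filter fun i => A i ω ≠ T (A i ω)).card : ℕ) : ℝ) =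
      ∑ i, z (A i ω) := by
    intro ω
    rw [Finset.card_filter]
    push_cast
    refine Finset.sum_congr rfl fun i _ => ?_
    simp [hz, hB, Set.indicator_apply]
  have hTd : ∀ x, T x ∈ Set.Icc (b - d) (b + d) := by
    intro x
    rw [hT]
    split_ifs with h
    · have := abs_le.mp h
      constructor <;> linarith
    · constructor <;> linarith
  have hTz : ∀ x ∈ Set.Icc (0 : ℝ) 1, |T x - x| ≤ z x := by
    intro x hx
    by_cases hxB : x ∈ B
    · have h1 : T x = b := by
        have : x ≠ T x := hxB
        rw [hT] at this ⊢
        split_ifs at this ⊢ <;> simp_all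
      have h2 : z x = 1 := by simp [hz, hxB]
      rw [h1, h2, abs_le]
      constructor <;> linarith [hx.1, hx.2, hb.1, hb.2]
    · have h1 : x = T x := not_not.mp hxB
      rw [← h1, sub_self, abs_zero]
      exact (hz01 x).1
  have hintA : ∀ i, Integrable (A i) P := fun i =>
    Integrable.of_mem_Icc 0 1 (hA i).aemeasurable (Filter.Eventually.of_forall (hA01 i))
  have hintT : ∀ i, Integrable (fun ω => T (A i ω)) P := fun i =>
    Integrable.of_mem_Icc (b - d) (b + d) (hTm.comp (hA i)).aemeasurable
      (Filter.Eventually.of_forall fun ω => hTd _)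
  have hintz : ∀ i, Integrable (fun ω => z (A i ω)) P := fun i =>
    Integrable.of_mem_Icc 0 1 (hzm.comp (hA i)).aemeasurable
      (Filter.Eventually.of_forall fun ω => hz01 _)
  -- Truncation moves a point of `[0,1]` by at most `1`, and only when it occurs.
  have hbias : |∑ i, ∫ ω, T (A i ω) ∂P - n * a| ≤ ∑ i, q i := by
    have h1 : ∑ i, ∫ ω, T (A i ω) ∂P - n * a = ∑ i, ∫ ω, (T (A i ω) - A i ω) ∂P := by
      simp only [integral_sub (hintT _) (hintA _), Finset.sum_sub_distrib, hAa]
      simp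
    rw [h1]
    refine (Finset.abs_sum_le_sum_abs _ _).trans (Finset.sum_le_sum fun i _ => ?_)
    rw [← hzq i]
    exact abs_integral_le_integral_abs.trans
      (integral_mono ((hintT i).sub (hintA i)).abs (hintz i) fun ω => hTz _ (hA01 i ω))
  have E1 := measureReal_le_abs_sum_sub_le (Y := fun i ω => T (A i ω))
    (fun i => hTm.comp (hA i)) (hindep.comp (fun _ => T) fun _ => hTm) (fun i ω => hTd _)
    (c := n * (√(2 / α) * (d / √n))) (by positivity)
  have E2 := measureReal_le_abs_sum_sub_le (Y := fun i ω => z (A i ω))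
    (fun i => hzm.comp (hA i)) (hindep.comp (fun _ => z) fun _ => hzm) (fun i ω => hz01 _)
    (c := n * (1 / √α / √n)) (by positivity)
  have e1 : (n : ℝ) * ((b + d - (b - d)) / 2) ^ 2 / (n * (√(2 / α) * (d / √n))) ^ 2 = α / 2 := by
    simp only [mul_pow, div_pow, hsn2, hs2α2]
    field_simp
    ring
  have e2 : (n : ℝ) * ((1 - 0) / 2) ^ 2 / (n * (1 / √α / √n)) ^ 2 = α / 4 := by
    simp only [mul_pow, div_pow, hsn2, hsα2]
    field_simp
    ring
  rw [e1] at E1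
  rw [e2] at E2
  simp only [hzq] at E2
  -- The inequality on `∑ q i` is deterministic: either the event is empty, or having no truncation
  -- has probability at most `exp (-log (4/α)) = α/4`.
  have E3 : P.real {ω | (∀ i, A i ω ∉ B) ∧ Real.log (4 / α) < ∑ i, q i} ≤ α / 4 := by
    by_cases hlt : Real.log (4 / α) < ∑ i, q i
    · simp only [hlt, and_true]
      refine (measureReal_forall_notMem_le hA hindep hBm).trans ?_
      rw [show α / 4 = Real.exp (-Real.log (4 / α)) by
        rw [Real.exp_neg, Real.exp_log (by positivity), inv_div]]
      exact Real.exp_le_exp.mpr (neg_le_neg hlt.le)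
    · simp [hlt]
      positivity
  -- Outside the three events, `n` times the error is less than the Chebyshev term plus `∑ q i`, and
  -- `∑ q i` is at most `n` times the width chosen according to `N`. The failures add up to `α/2 +
  -- α/4 + α/4`.
  have hsub : {ω | √(2 / α) * (d / √n) +
        truncWidth (Finset.univ.filter fun i => A i ω ≠ T (A i ω)).card n (α / 2) <
        |(∑ i, T (A i ω)) / n - a|} ⊆
      ({ω | n * (√(2 / α) * (d / √n)) ≤ |∑ i, T (A i ω) - ∑ i, ∫ ω, T (A i ω) ∂P|} ∪
        {ω | n * (1 / √α / √n) ≤ |∑ i, z (A i ω) - ∑ i, q i|}) ∪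
        {ω | (∀ i, A i ω ∉ B) ∧ Real.log (4 / α) < ∑ i, q i} := by
    intro ω hω
    by_contra hcon
    simp only [Set.mem_union, Set.mem_ofPred_eq, not_or, not_le, not_and, not_lt] at hcon hω
    obtain ⟨⟨h1, h2⟩, h3⟩ := hcon
    set w := truncWidth (Finset.univ.filter fun i => A i ω ≠ T (A i ω)).card n (α / 2) with hw
    have h4 : n * (√(2 / α) * (d / √n) + w) < |∑ i, T (A i ω) - n * a| := by
      have : |∑ i, T (A i ω) - n * a| = n * |(∑ i, T (A i ω)) / n - a| := by
        rw [← abs_of_pos hn0, ← abs_mul, abs_of_pos hn0]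
        congr 1
        field_simp
      rw [this]
      exact mul_lt_mul_of_pos_left hω hn0
    have h5 := abs_sub_le (∑ i, T (A i ω)) (∑ i, ∫ ω, T (A i ω) ∂P) (n * a)
    have h6 : n * w < ∑ i, q i := by linarith
    rw [hw, truncWidth] at h6
    split_ifs at h6 with hcard
    · have h7 : ∀ i, A i ω ∉ B := by
        intro i hi
        rw [Finset.card_eq_zero, Finset.filter_eq_empty_iff] at hcard
        exact hcard (Finset.mem_univ i) hi
      have h8 := h3 h7
      rw [mul_div_cancel₀ _ hn0.ne', show 2 / (α / 2) = 4 / α by field_simp; norm_num] at h6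
      linarith
    · rw [hN, show 2 * (α / 2) = α by ring, mul_add, mul_div_cancel₀ _ hn0.ne'] at h6
      linarith [(abs_lt.mp h2).1]
  calc _ ≤ _ := measureReal_mono hsub
    _ ≤ _ := measureReal_union_le _ _
    _ ≤ _ := add_le_add_left (measureReal_union_le _ _) _
    _ ≤ _ := by linarith

/-- Conditioning on `U`, elementary because `U` takes finitely many values. -/
theorem measureReal_le_of_indepFun {Ω α β : Type*} [MeasurableSpace Ω] {P : Measure Ω}
    [IsProbabilityMeasure P] [Finite α] [MeasurableSpace α] [MeasurableSingletonClass α]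
    [MeasurableSpace β] {U : Ω → α} {V : Ω → β} (hU : Measurable U)
    (h : IndepFun U V P) {B : α → Set β} (hB : ∀ u, MeasurableSet (B u)) {c : ℝ}
    (hc : ∀ u, P.real (V ⁻¹' B u) ≤ c) : P.real {ω | V ω ∈ B (U ω)} ≤ c := by
  have := Fintype.ofFinite α
  have hsub : {ω | V ω ∈ B (U ω)} ⊆ ⋃ u, U ⁻¹' {u} ∩ V ⁻¹' B u := by
    intro ω hω
    exact Set.mem_iUnion.mpr ⟨U ω, rfl, hω⟩
  have h1 : ∀ u, P.real (U ⁻¹' {u} ∩ V ⁻¹' B u) = P.real (U ⁻¹' {u}) * P.real (V ⁻¹' B u) := by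
    intro u
    simp only [measureReal_def, ← ENNReal.toReal_mul]
    rw [h.measure_inter_preimage_eq_mul _ _ (measurableSet_singleton u) (hB u)]
  have h2 : ∑ u, P.real (U ⁻¹' {u}) = 1 := by
    have h3 := sum_measureReal_preimage_singleton (μ := P) (f := U) Finset.univ
      fun u _ => hU (measurableSet_singleton u)
    rw [h3]
    simp
  calc _ ≤ _ := measureReal_mono hsub
    _ ≤ _ := measureReal_iUnion_fintype_le _
    _ ≤ ∑ u, P.real (U ⁻¹' {u}) * c := Finset.sum_le_sum fun u _ => by
        rw [h1]
        exact mul_le_mul_of_nonneg_left (hc u) measureReal_nonneg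
    _ = c := by rw [← Finset.sum_mul, h2, one_mul]


/-! ### Deterministic estimates for the interval. -/

section Interval

variable {n m : ℕ}

theorem chainAvg_mem_Icc (hm : 0 < m) {y : Fin n → Fin m → ℝ}
    (hy : ∀ i j, y i j ∈ Set.Icc (0 : ℝ) 1) (i : Fin n) : chainAvg y i ∈ Set.Icc (0 : ℝ) 1 := by
  have hm0 : (0 : ℝ) < m := by exact_mod_cast hm
  refine ⟨div_nonneg (Finset.sum_nonneg fun j _ => (hy i j).1) hm0.le, ?_⟩
  rw [chainAvg, div_le_one hm0]
  exact (Finset.sum_le_sum fun j _ => (hy i j).2).trans (by simp)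

theorem overallAvg_mem_of_convex (hn : 0 < n) {s : Set ℝ} (hs : Convex ℝ s)
    {y : Fin n → Fin m → ℝ} (hy : ∀ i, chainAvg y i ∈ s) : overallAvg y ∈ s := by
  have hn0 : (0 : ℝ) < n := by exact_mod_cast hn
  have h1 := hs.sum_mem (t := Finset.univ) (w := fun _ : Fin n => (1 / n : ℝ))
    (fun _ _ => by positivity) (by simp [hn0.ne']) fun i _ => hy i
  have h2 : overallAvg y = ∑ i, (1 / n : ℝ) • chainAvg y i := by
    rw [overallAvg, Finset.sum_div]
    exact Finset.sum_congr rfl fun i _ => by rw [smul_eq_mul]; ring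
  rwa [h2]

/-- Both sides agree because `err` is `1 / √(n · min (n, m/τ))`. This turns the Chebyshev term at
level `d` into the stated half-length. -/
theorem err_mul_log (hn : 0 < n) (hm : 0 < m) {τ : ℝ} (hτ : 0 < τ) :
    err n m τ * Real.log n = truncLevel n m τ / √n := by
  have hn0 : (0 : ℝ) < n := by exact_mod_cast hn
  have hm0 : (0 : ℝ) < m := by exact_mod_cast hm
  have key : err n m τ = (√(min (n : ℝ) (m / τ)) * √n)⁻¹ := by
    rw [err]
    rcases le_total (n : ℝ) (m / τ) with h | h
    · rw [min_eq_left h, Real.mul_self_sqrt hn0.le, one_div]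
      refine max_eq_left (Real.sqrt_le_iff.mpr ⟨by positivity, ?_⟩)
      rw [le_div_iff₀ hτ] at h
      rw [div_le_iff₀ (by positivity)]
      field_simp
      linarith
    · rw [min_eq_right h, ← Real.sqrt_mul (by positivity), ← Real.sqrt_inv,
        show (m / τ * n : ℝ)⁻¹ = τ / (n * m) by field_simp]
      refine max_eq_right (Real.le_sqrt_of_sq_le ?_)
      rw [div_le_iff₀ hτ] at h
      rw [le_div_iff₀ (by positivity)]
      field_simp
      linarith
  rw [key, truncLevel, div_div, mul_comm, ← div_eq_mul_inv]

theorem one_le_log_natCast (hn : 3 ≤ n) : 1 ≤ Real.log n := by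
  rw [Real.le_log_iff_exp_le (by positivity)]
  have : (3 : ℝ) ≤ n := by exact_mod_cast hn
  linarith [Real.exp_one_lt_three]

theorem truncLevel_pos (hn : 3 ≤ n) (hm : 0 < m) {τ : ℝ} (hτ : 0 < τ) : 0 < truncLevel n m τ := by
  have hn0 : (0 : ℝ) < n := by positivity
  have hm0 : (0 : ℝ) < m := by exact_mod_cast hm
  exact div_pos (by linarith [one_le_log_natCast hn])
    (Real.sqrt_pos.mpr (lt_min hn0 (by positivity)))

theorem log_div_sqrt_le_truncLevel (hn : 3 ≤ n) (hm : 0 < m) {τ : ℝ} (hτ : 0 < τ) :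
    Real.log n / √n ≤ truncLevel n m τ := by
  have hn0 : (0 : ℝ) < n := by positivity
  have hm0 : (0 : ℝ) < m := by exact_mod_cast hm
  exact div_le_div_of_nonneg_left (by linarith [one_le_log_natCast hn])
    (Real.sqrt_pos.mpr (lt_min hn0 (by positivity))) (Real.sqrt_le_sqrt (min_le_left _ _))

/-- The pilot mean is as close to `a` as the pilot averages are, so each `A i` is within twice `log
n / (2√n)` of it, which is at most the truncation level. -/
theorem numTrunc_eq_zero (hn : 3 ≤ n) (hm : 0 < m) {τ : ℝ} (hτ : 0 < τ)
    {ys y : Fin n → Fin m → ℝ} {a : ℝ}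
    (hys : ∀ i, |chainAvg ys i - a| ≤ Real.log n / (2 * √n))
    (hy : ∀ i, |chainAvg y i - a| ≤ Real.log n / (2 * √n)) : numTrunc τ ys y = 0 := by
  have h1 : overallAvg ys ∈ Metric.closedBall a (Real.log n / (2 * √n)) :=
    overallAvg_mem_of_convex (by omega) (convex_closedBall _ _) fun i => by
      rw [Metric.mem_closedBall, Real.dist_eq]
      exact hys i
  rw [Metric.mem_closedBall, Real.dist_eq, abs_sub_comm] at h1
  have h2 : Real.log n / (2 * √n) + Real.log n / (2 * √n) = Real.log n / √n := by
    field_simp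
    norm_num
  rw [numTrunc, Finset.card_eq_zero, Finset.filter_eq_empty_iff]
  intro i _
  rw [not_not, truncAvg, if_pos]
  linarith [abs_sub_le (chainAvg y i) a (overallAvg ys), hy i,
    log_div_sqrt_le_truncLevel hn hm hτ]

theorem two_mul_halfLength_le (hn : 3 ≤ n) {τ α : ℝ} (hα_pos : 0 < α) (hα_lt : α < 1)
    {ys y : Fin n → Fin m → ℝ} (hN : numTrunc τ ys y = 0) :
    2 * halfLength τ α ys y ≤ kConst α * err n m τ * Real.log n := by
  have hn0 : (0 : ℝ) < n := by positivity
  have h1 : 0 ≤ Real.log (4 / α) := Real.log_nonneg (by rw [le_div_iff₀ hα_pos]; linarith)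
  have h2 : 1 / (n : ℝ) ≤ err n m τ * Real.log n := by
    have h3 : 1 / (n : ℝ) ≤ err n m τ := le_max_left _ _
    have h4 : 0 ≤ 1 / (n : ℝ) := by positivity
    nlinarith [one_le_log_natCast hn]
  rw [halfLength, hN, truncWidth, if_pos rfl, kConst,
    show 2 / (α / 2) = 4 / α by field_simp; norm_num]
  have h3 := mul_le_mul_of_nonneg_left h2 h1
  rw [mul_one_div] at h3
  linarith

end Interval

/-! ### Bounds for families of chains. -/

section Chains

variable {S : Type*} [Fintype S] [DecidableEq S] [MeasurableSpace S] [MeasurableSingletonClass S]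
  {Ω : Type*} [MeasurableSpace Ω] {P : Measure Ω} [IsProbabilityMeasure P]
  {π : S → ℝ} {K : Matrix S S ℝ} {n m : ℕ} {hm : 1 ≤ m} {Xs X : Fin n → Fin m → Ω → S}

theorem measureReal_halfLength_lt_of_pilot (hπ : π ∈ stdSimplex ℝ S) (hK : ∀ i j, 0 ≤ K i j)
    (hK_sum : ∀ i, ∑ j, K i j = 1) (hrev : ∀ i j, π i * K i j = π j * K j i)
    {g : S → ℝ} (hg : ∀ s, 0 ≤ g s ∧ g s ≤ 1) (hn : 3 ≤ n) {α : ℝ} (hα : 0 < α)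
    {τ : ℝ} (hτ : 0 < τ) (hX : ∀ i, IsChain P π K hm (X i))
    (hindep : iIndepFun (fun i ω j => X i j ω) P) {ys : Fin n → Fin m → ℝ}
    (hys : ∀ i j, ys i j ∈ Set.Icc (0 : ℝ) 1) :
    P.real {ω | halfLength τ α ys (fun i j => g (X i j ω)) <
      |truncMean τ ys (fun i j => g (X i j ω)) - ∑ s, π s * g s|} ≤ α := by
  have hF : Measurable fun x : Fin m → S => (∑ j, g (x j)) / (m : ℝ) := measurable_of_finite _
  have key := measureReal_truncation_le (P := P) (n := n) (by omega)
    (A := fun i ω => (∑ j, g (X i j ω)) / (m : ℝ))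
    (fun i => hF.comp (hX i).measurable_path) (hindep.comp _ fun _ => hF)
    (fun i ω => chainAvg_mem_Icc (y := fun i j => g (X i j ω)) hm (fun i j => hg _) i)
    (fun i => (hX i).integral_avg hπ.1 hK hK_sum hrev g)
    (overallAvg_mem_of_convex (by omega) (convex_Icc 0 1) fun i => chainAvg_mem_Icc hm hys i)
    (truncLevel_pos hn hm hτ) hα (fun x => rfl)
  refine le_trans (le_of_eq ?_) key
  congr 1
  ext ω
  simp only [Set.mem_ofPred_eq, halfLength, mul_assoc, err_mul_log (by omega : 0 < n) hm hτ]
  rfl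

theorem measureReal_exists_lt_abs_chainAvg_sub_le (hπ : π ∈ stdSimplex ℝ S)
    (hK : ∀ i j, 0 ≤ K i j) (hK_sum : ∀ i, ∑ j, K i j = 1)
    (hrev : ∀ i j, π i * K i j = π j * K j i) (hl : secondEigenvalue K < 1)
    {g : S → ℝ} (hg : ∀ s, 0 ≤ g s ∧ g s ≤ 1) (hX : ∀ i, IsChain P π K hm (X i))
    {ε : ℝ} (hε0 : 0 ≤ ε) (hε1 : ε ≤ 1) :
    P.real {ω | ∃ i, ε < |chainAvg (fun i j => g (X i j ω)) i - ∑ s, π s * g s|} ≤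
      n * (6 * Real.exp (-(m * ε ^ 2 * (1 - secondEigenvalue K) / 12))) := by
  have h1 : {ω | ∃ i, ε < |chainAvg (fun i j => g (X i j ω)) i - ∑ s, π s * g s|} =
      ⋃ i, {ω | ε < |(∑ j, g (X i j ω)) / m - ∑ s, π s * g s|} := by
    ext ω
    simp [chainAvg]
  rw [h1]
  refine (measureReal_iUnion_fintype_le _).trans ((Finset.sum_le_sum fun i _ =>
    (hX i).measureReal_lt_abs_avg_sub_le hπ hK hK_sum hrev hl hg hε0 hε1).trans (by simp))

omit [Fintype S] [DecidableEq S] [MeasurableSingletonClass S] [IsProbabilityMeasure P] in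
theorem indepFun_of_iIndepFun_sumElim [IsProbabilityMeasure P]
    (hXs : ∀ i j, Measurable (Xs i j)) (hX : ∀ i j, Measurable (X i j))
    (hindep : iIndepFun (fun (c : Fin n ⊕ Fin n) (ω : Ω) (j : Fin m) => Sum.elim Xs X c j ω) P) :
    IndepFun (fun ω i j => Xs i j ω) (fun ω i j => X i j ω) P := by
  classical
  set s : Finset (Fin n ⊕ Fin n) := Finset.univ.map Function.Embedding.inl
  set t : Finset (Fin n ⊕ Fin n) := Finset.univ.map Function.Embedding.inr
  have hst : Disjoint s t := by
    simp [s, t, Finset.disjoint_left]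
  have hmeas : ∀ c, Measurable fun ω j => Sum.elim Xs X c j ω := by
    rintro (i | i)
    · exact measurable_pi_lambda _ (hXs i)
    · exact measurable_pi_lambda _ (hX i)
  have h1 := hindep.indepFun_finset s t hst hmeas
  exact h1.comp (φ := fun x i => x ⟨Sum.inl i, by simp [s]⟩)
    (ψ := fun x i => x ⟨Sum.inr i, by simp [t]⟩)
    (measurable_pi_lambda _ fun _ => measurable_pi_apply _)
    (measurable_pi_lambda _ fun _ => measurable_pi_apply _)

end Chains

end MCMC

/-! ### The two bounds assembled. -/

theorem theorem1 {S : Type*} [Fintype S] [DecidableEq S]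
    [MeasurableSpace S] [MeasurableSingletonClass S]
    (π : S → ℝ) (hπ : π ∈ stdSimplex ℝ S)
    (K : Matrix S S ℝ) (hK_nonneg : ∀ i j, 0 ≤ K i j) (hK_sum : ∀ i, ∑ j, K i j = 1)
    (hrev : ∀ i j, π i * K i j = π j * K j i)
    (g : S → ℝ) (hg : ∀ s, 0 ≤ g s ∧ g s ≤ 1)
    (n m : ℕ) (hn : 3 ≤ n) (hm : 1 ≤ m)
    (α : ℝ) (hα_pos : 0 < α) (hα_lt : α < 1) (τ : ℝ) (hτ : 1 ≤ τ)
    {Ω : Type*} [MeasurableSpace Ω] (P : Measure Ω) [IsProbabilityMeasure P]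
    (Xs X : Fin n → Fin m → Ω → S)
    (hXs : ∀ i, MCMC.IsChain P π K hm (Xs i)) (hX : ∀ i, MCMC.IsChain P π K hm (X i))
    (hindep : iIndepFun (fun (c : Fin n ⊕ Fin n) (ω : Ω) (j : Fin m) => Sum.elim Xs X c j ω) P)
    (I : Ω → Set ℝ)
    (hI : ∀ ω, I ω =
      MCMC.confInterval τ α (fun i j => g (Xs i j ω)) (fun i j => g (X i j ω))) :
    P.real {ω | ∑ s, π s * g s ∉ I ω} ≤ α ∧
    P.real {ω | ENNReal.ofReal (MCMC.kConst α * MCMC.err n m τ * Real.log n) < volume (I ω)} ≤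
      3 * n * (n + 1) *
        Real.exp (-((m : ℝ≥0∞) / (48 * n * MCMC.relaxationTime K)).toReal * Real.log n ^ 2) := by
  have hτ0 : 0 < τ := by linarith
  have hmX : ∀ i j, Measurable (X i j) := fun i j => (hX i).measurable j
  have hmXs : ∀ i j, Measurable (Xs i j) := fun i j => (hXs i).measurable j
  obtain rfl : I = fun ω => MCMC.confInterval τ α (fun i j => g (Xs i j ω))
    (fun i j => g (X i j ω)) := funext hI
  constructor
  · have key := MCMC.measureReal_le_of_indepFun (P := P) (U := fun ω i j => Xs i j ω)
      (V := fun ω i j => X i j ω)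
      (measurable_pi_lambda _ fun i => measurable_pi_lambda _ (hmXs i))
      (MCMC.indepFun_of_iIndepFun_sumElim hmXs hmX hindep)
      (B := fun u => {v | MCMC.halfLength τ α (fun i j => g (u i j)) (fun i j => g (v i j)) <
        |MCMC.truncMean τ (fun i j => g (u i j)) (fun i j => g (v i j)) - ∑ s, π s * g s|})
      (fun u => (Set.toFinite _).measurableSet) (c := α)
      fun u => MCMC.measureReal_halfLength_lt_of_pilot hπ hK_nonneg hK_sum hrev hg hn hα_pos hτ0
        hX (hindep.precomp Sum.inr_injective) fun i j => hg _
    refine le_trans (le_of_eq ?_) key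
    congr 1
    ext ω
    simp only [Set.mem_ofPred_eq, MCMC.confInterval]
    rw [← not_le, not_iff_not, abs_le, Set.mem_Icc]
    constructor <;> rintro ⟨h1, h2⟩ <;> constructor <;> linarith
  · have hn3 : (3 : ℝ) ≤ n := by exact_mod_cast hn
    have hn0 : (0 : ℝ) < n := by linarith
    rcases lt_or_ge (MCMC.secondEigenvalue K) 1 with hl | hl
    · have hexp : ((m : ℝ≥0∞) / (48 * n * MCMC.relaxationTime K)).toReal =
          m * (1 - MCMC.secondEigenvalue K) / (48 * n) := by
        rw [MCMC.relaxationTime, ENNReal.toReal_div, ENNReal.toReal_mul, ENNReal.toReal_inv,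
          ENNReal.toReal_ofReal (by linarith)]
        have : (1 - MCMC.secondEigenvalue K) ≠ 0 := by linarith
        simp
        field_simp
      have hs : 0 < √(n : ℝ) := Real.sqrt_pos.mpr hn0
      have hlog := MCMC.one_le_log_natCast hn
      -- Here `ε² / 12 = log² n / (48 n)`, the source of the constant `48`; moreover `ε = log √n /
      -- √n ≤ 1`.
      set ε := Real.log n / (2 * √n) with hε
      have hε0 : 0 ≤ ε := by positivity
      have hε1 : ε ≤ 1 := by
        rw [hε, div_le_one (by positivity)]
        have h1 := Real.log_le_sub_one_of_pos hs
        rw [Real.log_sqrt hn0.le] at h1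
        linarith
      have hεsq : ε ^ 2 = Real.log n ^ 2 / (4 * n) := by
        rw [hε, div_pow, mul_pow, Real.sq_sqrt hn0.le]
        norm_num
      have h1 := MCMC.measureReal_exists_lt_abs_chainAvg_sub_le hπ hK_nonneg hK_sum hrev hl hg hXs
        hε0 hε1
      have h2 := MCMC.measureReal_exists_lt_abs_chainAvg_sub_le hπ hK_nonneg hK_sum hrev hl hg hX
        hε0 hε1
      have hexp2 : -(m * ε ^ 2 * (1 - MCMC.secondEigenvalue K) / 12) =
          -((m : ℝ≥0∞) / (48 * n * MCMC.relaxationTime K)).toReal * Real.log n ^ 2 := by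
        rw [hexp, hεsq]
        field_simp
        norm_num
      rw [hexp2] at h1 h2
      refine (measureReal_mono ?_).trans ((measureReal_union_le _ _).trans
        ((add_le_add h1 h2).trans ?_))
      · intro ω hω
        by_contra hcon
        rw [Set.mem_union, not_or] at hcon
        simp only [Set.mem_ofPred_eq, not_exists, not_lt] at hcon hω
        have hlen := MCMC.two_mul_halfLength_le hn hα_pos hα_lt
          (MCMC.numTrunc_eq_zero hn hm hτ0 hcon.1 hcon.2)
        rw [MCMC.confInterval, Real.volume_Icc] at hω
        have := (ENNReal.ofReal_lt_ofReal_iff').mp hω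
        linarith [this.1]
      -- The union bound gives `12 n`, which is at most `3 n (n + 1)` since `n ≥ 3`.
      · rw [← mul_add, ← add_mul, show (6 + 6 : ℝ) = 12 by norm_num, ← mul_assoc]
        refine mul_le_mul_of_nonneg_right ?_ (Real.exp_pos _).le
        nlinarith
    -- Without a gap the relaxation time is `∞`, the exponent is `0`, and the bound exceeds `1`.
    · have hexp : ((m : ℝ≥0∞) / (48 * n * MCMC.relaxationTime K)).toReal = 0 := by
        rw [MCMC.relaxationTime, ENNReal.ofReal_of_nonpos (by linarith)]
        have : (48 * n : ℝ≥0∞) ≠ 0 := by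
          simp
          omega
        simp [ENNReal.mul_top this]
      rw [hexp, neg_zero, zero_mul, Real.exp_zero, mul_one]
      exact measureReal_le_one.trans (by nlinarith)
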